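/- For $n\ge 1$ write $\mathcal M_n$ for the complex $n\times n$ matrices, and $A\ge 0$ if $A\in\mathcal M_n$ is positive semidefinite. A density matrix is a positive semidefinite matrix of trace $1$, and a quantum channel $T:\mathcal M_d\to\mathcal M_{d'}$ is a completely positive, trace-preserving linear map. For positive semidefinite $A,B\in\mathcal M_n$ define the (generalized) fidelity $$F(A,B):=\operatorname{tr}\sqrt{A^{1/2}BA^{1/2}},$$ and, if $B\neq 0$, $$\inf(A/B):=\sup\{\lambda\in\mathbb R \mid A-\lambda B\ge 0\}.$$ **Theorem (Fidelity criterion for the existence of a quantum channel extension).** Let $\rho_1,\rho_2\in\mathcal M_d$ be density matrices with $d\le 2$, let $\rho'_1,\rho'_2\in\mathcal M_{d'}$ be density matrices ($d'\ge 1$ arbitrary), and put $a:=\inf(\rho_1/\rho_2)$ and $b:=\inf(\rho_2/\rho_1)$. Then there exists a quantum channel $T:\mathcal M_d\to\mathcal M_{d'}$ with $T(\rho_1)=\rho'_1$ and $T(\rho_2)=\rho'_2$ if and only if the following three conditions hold: $$\rho'_1-a\rho'_2\ \ge\ 0,\qquad \rho'_2-b\rho'_1\ \ge\ 0,$$ $$F(\rho'_1-a\rho'_2,\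 \rho'_2-b\rho'_1)\ \ge\ F(\rho_1-a\rho_2,\ \rho_2-b\rho_1).$$ -/

import Mathlib

open scoped MatrixOrder ComplexOrder Matrix.Norms.L2Operator

/-- A density matrix of size `d`: a positive semidefinite complex matrix of trace one. -/
structure IsDensityMatrix {d : ℕ} (ρ : Matrix (Fin d) (Fin d) ℂ) : Prop where
  posSemidef : ρ.PosSemidef
  trace_eq_one : ρ.trace = 1

/-- A quantum channel `M_d → M_{d'}`: a completely positive, trace-preserving linear map.
Complete positivity is with respect to the C⋆-algebra structure of the full matrix algebras, in
which `0 ≤ A` means that `A` is positive semidefinite. -/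
structure QuantumChannel (d d' : ℕ) extends
    CompletelyPositiveMap (Matrix (Fin d) (Fin d) ℂ) (Matrix (Fin d') (Fin d') ℂ) where
  trace_preserving : ∀ X : Matrix (Fin d) (Fin d) ℂ, (toLinearMap X).trace = X.trace

/-- The generalized fidelity `F(A, B) = tr √(A^{1/2} B A^{1/2})` of positive semidefinite `A`, `B`
(the trace is then a nonnegative real number). -/
noncomputable def fidelity {n : ℕ} (A B : Matrix (Fin n) (Fin n) ℂ) : ℝ :=
  (CFC.sqrt (CFC.sqrt A * B * CFC.sqrt A)).trace.re

/-- `inf(A/B) = sup {t ∈ ℝ | A - t B ≥ 0}`, for positive semidefinite `A` and `B` with `B ≠ 0`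
(the set is then nonempty and bounded above). -/
noncomputable def infRatio {n : ℕ} (A B : Matrix (Fin n) (Fin n) ℂ) : ℝ :=
  sSup {t : ℝ | (A - t • B).PosSemidef}

/-!
The fidelity of `A, B ≥ 0` is the largest modulus of `tr X` over all `X` that complete `A`, `B` to a
positive semidefinite block matrix with rows `(A, X)` and `(Xᴴ, B)`. Such a block matrix is handled
through a Gram factor: `A = G Gᴴ`, `X = G Hᴴ`, `B = H Hᴴ`. The two halves of this description are
`norm_trace_mul_conjTranspose_le_fidelity` and `exists_gram_of_norm_le_fidelity`; both rest on the
polar decomposition.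

Necessity. Put `A = ρ₁ - a ρ₂` and `B = ρ₂ - b ρ₁`, which are positive semidefinite because the
suprema defining `a` and `b` are attained. A channel preserves positivity and, by 2-positivity,
maps an optimal block matrix for `A`, `B` to an admissible one for the images with the same
off-diagonal trace. So it does not decrease the fidelity (`fidelity_le_fidelity_map`). This half
holds in every dimension.

Sufficiency. If `ρ₁ = ρ₂`, then `a = 1`, the first condition forces the two target states to agree,
and `X ↦ tr X • σ` is a suitable channel. Otherwise `d = 2` and `a, b < 1`, so that prescribing the
images of `ρ₁`, `ρ₂` amounts to prescribing those of `A`, `B`. Maximality of `a` and `b` makes `A`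
and `B` singular, hence `A = x xᴴ` and `B = y yᴴ`, and `x`, `y` form a basis of `ℂ²`. A linear map
on `M₂` is therefore fixed by the images of `x xᴴ`, `x yᴴ`, `y xᴴ`, `y yᴴ`; it is completely
positive when these images form a positive semidefinite block matrix, and trace preserving when
their traces are right (`QuantumChannel.exists_of_gram`). The diagonal blocks are prescribed and
have the right traces. As `|tr (x yᴴ)| ≤ F(A, B)`, the fidelity condition is what allows an
off-diagonal block with trace `tr (x yᴴ)` to be chosen.
-/

section

open Matrix

/-! ### Polar decomposition and contractions -/

/-- A Hermitian matrix has a commuting Hermitian generalized inverse, namely its image under the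
functional calculus of `x ↦ x⁻¹` with `0⁻¹ = 0`. -/
theorem exists_hermitian_pseudoinverse {n : Type*} [Fintype n] [DecidableEq n]
    {Q : Matrix n n ℂ} (hQ : Q.IsHermitian) :
    ∃ R : Matrix n n ℂ, R.IsHermitian ∧ Q * R = R * Q ∧ Q * R * Q = Q := by
  have hQ' : IsSelfAdjoint Q := hQ
  have hfin : (spectrum ℝ Q).Finite := Matrix.finite_real_spectrum
  have hc : ∀ f : ℝ → ℝ, ContinuousOn f (spectrum ℝ Q) := fun f => hfin.continuousOn f
  have h1 : Q * cfc (fun x : ℝ => x⁻¹) Q = cfc (fun x : ℝ => x * x⁻¹) Q := by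
    rw [cfc_mul (fun x : ℝ => x) _ Q (hc _) (hc _), cfc_id' ℝ Q]
  refine ⟨cfc (fun x : ℝ => x⁻¹) Q, cfc_predicate (fun x : ℝ => x⁻¹) Q, ?_, ?_⟩
  · have h := (cfc_commute_cfc (fun x : ℝ => x) (fun x : ℝ => x⁻¹) Q).eq
    rwa [cfc_id' ℝ Q] at h
  · rw [h1]
    calc cfc (fun x : ℝ => x * x⁻¹) Q * Q
        = cfc (fun x : ℝ => x * x⁻¹) Q * cfc (fun x : ℝ => x) Q := by rw [cfc_id' ℝ Q]
      _ = cfc (fun x : ℝ => x * x⁻¹ * x) Q := (cfc_mul _ _ Q (hc _) (hc _)).symm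
      _ = cfc (fun x : ℝ => x) Q := by simp
      _ = Q := cfc_id' ℝ Q

theorem posSemidef_sqrt {n : Type*} [Fintype n] [DecidableEq n] (P : Matrix n n ℂ) :
    (CFC.sqrt P).PosSemidef :=
  nonneg_iff_posSemidef.1 (CFC.sqrt_nonneg P)

theorem sqrt_mul_sqrt_of_posSemidef {n : Type*} [Fintype n] [DecidableEq n] {P : Matrix n n ℂ}
    (hP : P.PosSemidef) : CFC.sqrt P * CFC.sqrt P = P :=
  CFC.sqrt_mul_sqrt_self P (nonneg_iff_posSemidef.2 hP)

/-- Polar decomposition `G = √(G Gᴴ) U`. The factor `U` is a partial isometry; it suffices to record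
that it is a contraction in the operator norm and that `G Uᴴ = √(G Gᴴ)`. -/
theorem exists_polar_decomposition {m n : Type*} [Fintype m] [DecidableEq m] [Fintype n]
    [DecidableEq n] (G : Matrix m n ℂ) :
    ∃ U : Matrix m n ℂ, ‖U‖ ≤ 1 ∧ CFC.sqrt (G * Gᴴ) * U = G ∧ G * Uᴴ = CFC.sqrt (G * Gᴴ) := by
  set Q := CFC.sqrt (G * Gᴴ) with hQdef
  have hQ : Q.IsHermitian := (posSemidef_sqrt _).isHermitian
  have hQQ : Q * Q = G * Gᴴ := sqrt_mul_sqrt_of_posSemidef (posSemidef_self_mul_conjTranspose G)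
  obtain ⟨R, hR, hQR, hQRQ⟩ := exists_hermitian_pseudoinverse hQ
  have hGR : G * (R * G)ᴴ = Q := by
    rw [conjTranspose_mul, hR.eq, ← Matrix.mul_assoc, ← hQQ, Matrix.mul_assoc, hQR,
      ← Matrix.mul_assoc, hQRQ]
  refine ⟨R * G, ?_, ?_, hGR⟩
  · -- `U Uᴴ = R Q` is an orthogonal projection
    have hU : (R * G) * (R * G)ᴴ = R * Q := by rw [Matrix.mul_assoc, hGR]
    have hP : (R * Q) * (R * Q)ᴴ = R * Q := by
      rw [conjTranspose_mul, hQ.eq, hR.eq, hQR, Matrix.mul_assoc, ← Matrix.mul_assoc Q R Q, hQRQ]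
    have h1 : ‖R * Q‖ = ‖R * Q‖ * ‖R * Q‖ := by
      have := l2_opNorm_conjTranspose_mul_self (R * Q)ᴴ
      rwa [conjTranspose_conjTranspose, hP, l2_opNorm_conjTranspose] at this
    have h2 := l2_opNorm_conjTranspose_mul_self (R * G)ᴴ
    rw [conjTranspose_conjTranspose, hU, l2_opNorm_conjTranspose] at h2
    have h3 : 0 ≤ ‖R * G‖ := norm_nonneg _
    have h4 : ‖R * Q‖ ≤ 1 := by nlinarith [norm_nonneg (R * Q)]
    nlinarith
  · -- `1 - Q R` annihilates the range of `G`, because it annihilates `G Gᴴ`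
    have h : (G - Q * (R * G)) * (G - Q * (R * G))ᴴ = 0 := by
      rw [conjTranspose_sub, Matrix.mul_sub, Matrix.sub_mul, Matrix.sub_mul, conjTranspose_mul Q,
        hQ.eq, ← Matrix.mul_assoc G, hGR]
      have e1 : Q * (R * G) * Gᴴ = Q * Q := by
        rw [Matrix.mul_assoc, Matrix.mul_assoc, ← hQQ, ← Matrix.mul_assoc R, ← hQR, hQRQ]
      have e2 : Q * (R * G) * ((R * G)ᴴ * Q) = Q * Q := by
        rw [Matrix.mul_assoc, Matrix.mul_assoc, ← Matrix.mul_assoc G, hGR, ← Matrix.mul_assoc R,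
          ← hQR, hQRQ]
      rw [e1, e2, ← hQQ]; simp
    exact (sub_eq_zero.1 (self_mul_conjTranspose_eq_zero.1 h)).symm

theorem norm_le_one_iff_posSemidef_one_sub {m n : Type*} [Fintype m] [DecidableEq m] [Fintype n]
    [DecidableEq n] (U : Matrix m n ℂ) : ‖U‖ ≤ 1 ↔ (1 - U * Uᴴ).PosSemidef := by
  have h2 := l2_opNorm_conjTranspose_mul_self Uᴴ
  rw [conjTranspose_conjTranspose, l2_opNorm_conjTranspose] at h2
  rw [← le_iff, ← CStarAlgebra.norm_le_one_iff_of_nonneg (U * Uᴴ)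
    (nonneg_iff_posSemidef.2 (posSemidef_self_mul_conjTranspose U)), h2]
  constructor <;> intro h <;> nlinarith [norm_nonneg U]

/-- A contraction `C` satisfies `|tr (C Q)| ≤ tr Q` for `Q ≥ 0`: with `Q = S²` and a unit scalar `z`
for which `z tr (C Q) = |tr (C Q)|`, this is the sum of `0 ≤ tr ((S - z C S) (S - z C S)ᴴ)` and
`tr (S (z C)ᴴ (z C) S) ≤ tr S²`. -/
theorem norm_trace_mul_le {n : Type*} [Fintype n] [DecidableEq n] {C Q : Matrix n n ℂ}
    (hC : ‖C‖ ≤ 1) (hQ : Q.PosSemidef) : ‖(C * Q).trace‖ ≤ Q.trace.re := by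
  obtain ⟨S, hS, rfl⟩ : ∃ S : Matrix n n ℂ, S.IsHermitian ∧ Q = S * S :=
    ⟨CFC.sqrt Q, (posSemidef_sqrt Q).isHermitian, (sqrt_mul_sqrt_of_posSemidef hQ).symm⟩
  obtain ⟨z, hz, hzt⟩ : ∃ z : ℂ, ‖z‖ = 1 ∧ z * (C * (S * S)).trace = ‖(C * (S * S)).trace‖ := by
    obtain h | h := eq_or_ne (C * (S * S)).trace 0
    · exact ⟨1, by simp, by simp [h]⟩
    · refine ⟨‖(C * (S * S)).trace‖ / (C * (S * S)).trace, ?_, by field_simp⟩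
      rw [norm_div]; simp [h]
  set D := z • C with hD
  have hDn : ‖Dᴴ‖ ≤ 1 := by rw [l2_opNorm_conjTranspose, hD, norm_smul, hz, one_mul]; exact hC
  have h1 := (posSemidef_self_mul_conjTranspose (S - D * S)).trace_nonneg
  have h2 := (((norm_le_one_iff_posSemidef_one_sub _).1 hDn).mul_mul_conjTranspose_same
    S).trace_nonneg
  have e0 : (D * (S * S)).trace = ‖(C * (S * S)).trace‖ := by
    rw [hD, smul_mul, trace_smul, smul_eq_mul, hzt]
  have e0' : ((S * S) * Dᴴ).trace = ‖(C * (S * S)).trace‖ := by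
    have := congrArg star e0
    rw [← trace_conjTranspose, conjTranspose_mul, conjTranspose_mul, hS.eq] at this
    simpa using this
  have e1 : ((S - D * S) * (S - D * S)ᴴ).trace
      = (S * S).trace - 2 * ‖(C * (S * S)).trace‖ + (S * Dᴴ * D * S).trace := by
    rw [conjTranspose_sub, conjTranspose_mul, hS.eq, Matrix.mul_sub, Matrix.sub_mul, Matrix.sub_mul,
      trace_sub, trace_sub, trace_sub, ← Matrix.mul_assoc S S, e0', Matrix.mul_assoc D S S, e0,
      ← Matrix.mul_assoc (D * S), trace_mul_comm (D * S * S), Matrix.mul_assoc D,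
      ← Matrix.mul_assoc Dᴴ, ← Matrix.mul_assoc (Dᴴ * D) S S, trace_mul_comm (Dᴴ * D * S) S,
      ← Matrix.mul_assoc S, ← Matrix.mul_assoc S]
    ring
  have e2 : (S * (1 - Dᴴ * Dᴴᴴ) * Sᴴ).trace = (S * S).trace - (S * Dᴴ * D * S).trace := by
    rw [hS.eq, conjTranspose_conjTranspose, Matrix.mul_sub, Matrix.sub_mul, trace_sub,
      Matrix.mul_one, Matrix.mul_assoc S Dᴴ]
  rw [e1] at h1
  rw [e2] at h2
  have h3 := (Complex.le_def.1 (add_nonneg h1 h2)).1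
  simp at h3
  linarith

/-! ### The fidelity as a maximum over off-diagonal blocks -/

/-- The easy half of the block-matrix description of the fidelity: if `G`, `H` are the two rows of a
Gram factor of the block matrix with diagonal blocks `A`, `B` and off-diagonal block `X = G Hᴴ`,
then `|tr X| ≤ F(A, B)`. Indeed `X = √A K √B` for a contraction `K`, and the polar decomposition
of `√A √B` turns `tr X` into the trace of a contraction times `√(√A B √A)`. -/
theorem norm_trace_mul_conjTranspose_le_fidelity {n : ℕ} {ι : Type*} [Fintype ι] [DecidableEq ι]
    (G H : Matrix (Fin n) ι ℂ) : ‖(G * Hᴴ).trace‖ ≤ fidelity (G * Gᴴ) (H * Hᴴ) := by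
  obtain ⟨U, hU, hGU, -⟩ := exists_polar_decomposition G
  obtain ⟨V, hV, hHV, -⟩ := exists_polar_decomposition H
  set A := CFC.sqrt (G * Gᴴ) with hA
  set B := CFC.sqrt (H * Hᴴ) with hB
  have hA' : A.IsHermitian := (posSemidef_sqrt _).isHermitian
  have hB' : B.IsHermitian := (posSemidef_sqrt _).isHermitian
  have hBB : B * B = H * Hᴴ := sqrt_mul_sqrt_of_posSemidef (posSemidef_self_mul_conjTranspose H)
  obtain ⟨W, hW, hMW, -⟩ := exists_polar_decomposition (A * B)
  have e : A * B * (A * B)ᴴ = A * (H * Hᴴ) * A := by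
    rw [conjTranspose_mul, hA'.eq, hB'.eq, ← hBB]; simp only [Matrix.mul_assoc]
  rw [e] at hMW
  have hC : ‖U * Vᴴ * Wᴴ‖ ≤ 1 := by
    have h1 := l2_opNorm_mul (U * Vᴴ) Wᴴ
    have h2 := l2_opNorm_mul U Vᴴ
    rw [l2_opNorm_conjTranspose] at h1 h2
    calc _ ≤ _ := h1
      _ ≤ 1 * 1 := by
        gcongr
        exact h2.trans (mul_le_one₀ hU (norm_nonneg _) hV)
      _ = 1 := one_mul 1
  have key : (G * Hᴴ).trace = (U * Vᴴ * Wᴴ * CFC.sqrt (A * (H * Hᴴ) * A)).trace := by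
    have h1 : B * A = Wᴴ * CFC.sqrt (A * (H * Hᴴ) * A) := by
      have := congrArg conjTranspose hMW
      rw [conjTranspose_mul, conjTranspose_mul, hA'.eq, hB'.eq,
        (posSemidef_sqrt _).isHermitian.eq] at this
      exact this.symm
    rw [Matrix.mul_assoc (U * Vᴴ), ← h1]
    conv_lhs => rw [← hGU, ← hHV, conjTranspose_mul, hB'.eq]
    rw [Matrix.mul_assoc A, trace_mul_comm A]
    simp only [Matrix.mul_assoc]
  rw [key]
  exact norm_trace_mul_le hC (posSemidef_sqrt _)

/-- The converse half: every complex number of modulus at most `F(A, B)` is the trace of an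
off-diagonal block completing `A`, `B` to a positive semidefinite block matrix, given here by its
Gram factor. The block is `√A V √B`, with `V` a multiple of the polar factor of `√A √B`. -/
theorem exists_gram_of_norm_le_fidelity {n : ℕ} {A B : Matrix (Fin n) (Fin n) ℂ}
    (hA : A.PosSemidef) (hB : B.PosSemidef) {c : ℂ} (hc : ‖c‖ ≤ fidelity A B) :
    ∃ G H : Matrix (Fin n) (Fin n ⊕ Fin n) ℂ,
      G * Gᴴ = A ∧ H * Hᴴ = B ∧ (G * Hᴴ).trace = c := by
  set S := CFC.sqrt A with hS
  set R := CFC.sqrt B with hR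
  have hS' : S.IsHermitian := (posSemidef_sqrt _).isHermitian
  have hR' : R.IsHermitian := (posSemidef_sqrt _).isHermitian
  have hSS : S * S = A := sqrt_mul_sqrt_of_posSemidef hA
  have hRR : R * R = B := sqrt_mul_sqrt_of_posSemidef hB
  obtain ⟨W, hW, -, hMW⟩ := exists_polar_decomposition (S * R)
  have e : S * R * (S * R)ᴴ = S * B * S := by
    rw [conjTranspose_mul, hS'.eq, hR'.eq, ← hRR]; simp only [Matrix.mul_assoc]
  rw [e] at hMW
  have hF : (S * R * Wᴴ).trace = fidelity A B := by
    rw [hMW]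
    have := (posSemidef_sqrt (S * B * S)).trace_nonneg
    rw [fidelity, ← hS]
    exact Complex.ext (by simp) (by simpa using (Complex.le_def.1 this).2.symm)
  obtain ⟨z, hz, hzc⟩ : ∃ z : ℂ, ‖z‖ ≤ 1 ∧ z * fidelity A B = c := by
    obtain h | h := eq_or_ne (fidelity A B) 0
    · rw [h] at hc
      exact ⟨0, by simp, by simpa using (norm_le_zero_iff.1 hc).symm⟩
    · have hpos : 0 < fidelity A B := lt_of_le_of_ne ((norm_nonneg c).trans hc) h.symm
      refine ⟨c / fidelity A B, ?_, by field_simp⟩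
      rw [norm_div, Complex.norm_real, Real.norm_of_nonneg hpos.le]
      exact (div_le_one hpos).2 hc
  set V := z • W with hV
  have hVn : ‖V‖ ≤ 1 := by
    rw [hV, norm_smul]; exact mul_le_one₀ hz (norm_nonneg _) hW
  have hVtr : (S * V * R).trace = c := by
    have h := congrArg star hF
    rw [← trace_conjTranspose, conjTranspose_mul, conjTranspose_mul, hS'.eq, hR'.eq,
      conjTranspose_conjTranspose, trace_mul_comm, Matrix.mul_assoc, trace_mul_comm] at h
    rw [hV, Matrix.mul_smul, Matrix.smul_mul, trace_smul, smul_eq_mul, h, ← hzc]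
    simp
  set K := CFC.sqrt (1 - V * Vᴴ) with hK
  have hK' : K.IsHermitian := (posSemidef_sqrt _).isHermitian
  have hKK : K * K = 1 - V * Vᴴ :=
    sqrt_mul_sqrt_of_posSemidef ((norm_le_one_iff_posSemidef_one_sub V).1 hVn)
  refine ⟨fromCols (S * V) (S * K), fromCols R 0, ?_, ?_, ?_⟩
  · rw [conjTranspose_fromCols_eq_fromRows_conjTranspose, fromCols_mul_fromRows,
      conjTranspose_mul, conjTranspose_mul, hS'.eq, hK'.eq, Matrix.mul_assoc S V,
      Matrix.mul_assoc S K, ← Matrix.mul_assoc K, hKK, ← Matrix.mul_assoc V, ← Matrix.mul_add,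
      ← Matrix.add_mul, add_sub_cancel, Matrix.one_mul, hSS]
  · rw [conjTranspose_fromCols_eq_fromRows_conjTranspose, fromCols_mul_fromRows, hR'.eq, hRR]
    simp
  · rw [conjTranspose_fromCols_eq_fromRows_conjTranspose, fromCols_mul_fromRows, hR'.eq]
    simpa using hVtr

/-! ### Complete positivity through Gram families -/

theorem NonUnitalCStarAlgebra.nonneg_iff_exists_star_mul_self {B : Type*} [NonUnitalCStarAlgebra B]
    [PartialOrder B] [StarOrderedRing B] {x : B} : 0 ≤ x ↔ ∃ y, x = star y * y :=
  CStarAlgebra.nonneg_iff_eq_star_mul_self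

theorem CStarMatrix.nonneg_iff_exists_star_mul_self {k A : Type*} [Fintype k]
    [NonUnitalCStarAlgebra A] [PartialOrder A] [StarOrderedRing A] {M : CStarMatrix k k A} :
    0 ≤ M ↔ ∃ N : CStarMatrix k k A, M = star N * N :=
  NonUnitalCStarAlgebra.nonneg_iff_exists_star_mul_self

/-- A nonnegative matrix over a matrix algebra is a Gram family: its entries are `G i (G j)ᴴ`. -/
theorem CStarMatrix.exists_gram_of_nonneg {k m : Type*} [Fintype k] [DecidableEq k] [Fintype m]
    [DecidableEq m] {M : CStarMatrix k k (Matrix m m ℂ)} (hM : 0 ≤ M) :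
    ∃ G : k → Matrix m (k × m) ℂ, ∀ i j, M i j = G i * (G j)ᴴ := by
  obtain ⟨N, rfl⟩ := CStarMatrix.nonneg_iff_exists_star_mul_self.1 hM
  refine ⟨fun i => of fun p lq => star (N lq.1 i lq.2 p), fun i j => ?_⟩
  ext p q
  simp only [CStarMatrix.mul_apply, CStarMatrix.star_apply, Matrix.sum_apply, Matrix.mul_apply,
    Matrix.star_apply, Fintype.sum_prod_type]
  simp

/-- A Gram family `G i (G j)ᴴ` is a nonnegative matrix over the matrix algebra. The columns of the
`G i` may be indexed by any finite type; flattening to a scalar matrix and taking its square root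
produces the square factor that the C⋆-order asks for. -/
theorem CStarMatrix.nonneg_of_gram {k m ι : Type*} [Fintype k] [DecidableEq k] [Fintype m]
    [DecidableEq m] [Fintype ι] {M : CStarMatrix k k (Matrix m m ℂ)} (G : k → Matrix m ι ℂ)
    (hM : ∀ i j, M i j = G i * (G j)ᴴ) : 0 ≤ M := by
  set P : Matrix (k × m) (k × m) ℂ := of fun ip jq => M ip.1 jq.1 ip.2 jq.2 with hP
  have hPs : P.PosSemidef := by
    have : P = (of fun (ip : k × m) r => G ip.1 ip.2 r) *
        (of fun (ip : k × m) r => G ip.1 ip.2 r)ᴴ := by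
      ext ⟨i, p⟩ ⟨j, q⟩
      simp [hP, hM, Matrix.mul_apply]
    rw [this]
    exact posSemidef_self_mul_conjTranspose _
  have hS := sqrt_mul_sqrt_of_posSemidef hPs
  have hS' := (posSemidef_sqrt P).isHermitian
  set S := CFC.sqrt P
  refine CStarMatrix.nonneg_iff_exists_star_mul_self.2
    ⟨CStarMatrix.ofMatrix (of fun i j => of fun p q => S (i, p) (j, q)), ?_⟩
  ext i j p q
  have h1 : M i j p q = P (i, p) (j, q) := rfl
  rw [h1, ← hS]
  simp only [CStarMatrix.mul_apply, CStarMatrix.star_apply, Matrix.sum_apply, Matrix.mul_apply,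
    Matrix.star_apply, Fintype.sum_prod_type, CStarMatrix.ofMatrix_apply, of_apply, hS'.apply]

theorem QuantumChannel.exists_gram {d d' : ℕ} (T : QuantumChannel d d') {k : ℕ} {ι : Type*}
    [Fintype ι] (G : Fin k → Matrix (Fin d) ι ℂ) :
    ∃ H : Fin k → Matrix (Fin d') (Fin k × Fin d') ℂ,
      ∀ i j, T.toLinearMap (G i * (G j)ᴴ) = H i * (H j)ᴴ :=
  CStarMatrix.exists_gram_of_nonneg <| T.map_cstarMatrix_nonneg' k
    (CStarMatrix.ofMatrix (of fun i j => G i * (G j)ᴴ)) <|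
    CStarMatrix.nonneg_of_gram G fun _ _ => rfl

/-- The quantum channel `X ↦ ∑ r, K r * X * (K r)ᴴ` with Kraus operators `K r`. -/
noncomputable def QuantumChannel.ofKraus {d d' : ℕ} {κ : Type*} [Fintype κ]
    (K : κ → Matrix (Fin d') (Fin d) ℂ) (hK : ∑ r, (K r)ᴴ * K r = 1) : QuantumChannel d d' where
  toFun X := ∑ r, K r * X * (K r)ᴴ
  map_add' X Y := by simp [Matrix.mul_add, Matrix.add_mul, Finset.sum_add_distrib]
  map_smul' c X := by simp [Finset.smul_sum]
  map_cstarMatrix_nonneg' k M hM := by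
    obtain ⟨G, hG⟩ := CStarMatrix.exists_gram_of_nonneg hM
    refine CStarMatrix.nonneg_of_gram
      (fun i => of fun p (rs : κ × (Fin k × Fin d)) => (K rs.1 * G i) p rs.2) fun i j => ?_
    ext p q
    have h : ∀ r, K r * (G i * (G j)ᴴ) * (K r)ᴴ = (K r * G i) * (K r * G j)ᴴ := fun r => by
      simp only [conjTranspose_mul, Matrix.mul_assoc]
    simp only [CStarMatrix.map_apply, LinearMap.coe_mk, AddHom.coe_mk, hG, h, Matrix.sum_apply]
    rw [Matrix.mul_apply, Fintype.sum_prod_type]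
    rfl
  trace_preserving X := by
    simp only [LinearMap.coe_mk, AddHom.coe_mk, trace_sum]
    simp_rw [Matrix.mul_assoc, trace_mul_comm (K _), Matrix.mul_assoc]
    rw [← trace_sum, ← Finset.mul_sum, hK, Matrix.mul_one]

/-- An invertible `V` and matrices `G s` determine a linear map sending `v_s v_tᴴ` to `G s (G t)ᴴ`,
where `v_s` is the `s`-th column of `V`. It is completely positive, and it is trace preserving as
soon as the traces of the images are the inner products of the columns. Its Kraus operators are
`L r V⁻¹`, where the columns of `L r` are the `r`-th columns of the `G s`. -/
theorem QuantumChannel.exists_of_gram {d d' : ℕ} {ι : Type*} [Fintype ι]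
    (V : Matrix (Fin d) (Fin d) ℂ) (hV : IsUnit V.det) (G : Fin d → Matrix (Fin d') ι ℂ)
    (hG : ∀ s t, (G s * (G t)ᴴ).trace = (Vᴴ * V) t s) :
    ∃ T : QuantumChannel d d', ∀ s t,
      T.toLinearMap (V * single s t 1 * Vᴴ) = G s * (G t)ᴴ := by
  set L : ι → Matrix (Fin d') (Fin d) ℂ := fun r => of fun p s => G s p r with hL
  have hLL : ∑ r, (L r)ᴴ * L r = Vᴴ * V := by
    ext t s
    rw [← hG, trace, Matrix.sum_apply]
    simp only [Matrix.mul_apply, conjTranspose_apply, hL, of_apply, diag_apply]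
    rw [Finset.sum_comm]
    simp_rw [mul_comm]
  have hV1 : V⁻¹ * V = 1 := nonsing_inv_mul V hV
  have hV2 : V * V⁻¹ = 1 := mul_nonsing_inv V hV
  have hV3 : Vᴴ * V⁻¹ᴴ = 1 := by rw [← conjTranspose_mul, hV1, conjTranspose_one]
  have hV4 : V⁻¹ᴴ * Vᴴ = 1 := by rw [← conjTranspose_mul, hV2, conjTranspose_one]
  refine ⟨QuantumChannel.ofKraus (fun r => L r * V⁻¹) ?_, fun s t => ?_⟩
  · have h : ∀ r, (L r * V⁻¹)ᴴ * (L r * V⁻¹) = V⁻¹ᴴ * ((L r)ᴴ * L r) * V⁻¹ := fun r => by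
      simp only [conjTranspose_mul, Matrix.mul_assoc]
    simp_rw [h]
    rw [← Finset.sum_mul, ← Finset.mul_sum, hLL, ← Matrix.mul_assoc, hV4, Matrix.one_mul, hV2]
  · have h : ∀ r, L r * V⁻¹ * (V * single s t 1 * Vᴴ) * (L r * V⁻¹)ᴴ
        = L r * (single s t 1 : Matrix (Fin d) (Fin d) ℂ) * (L r)ᴴ := fun r => by
      calc _ = L r * (V⁻¹ * V) * (single s t 1 : Matrix (Fin d) (Fin d) ℂ) * (Vᴴ * V⁻¹ᴴ) * (L r)ᴴ := by
            simp only [conjTranspose_mul, Matrix.mul_assoc]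
        _ = _ := by rw [hV1, hV3, Matrix.mul_one, Matrix.mul_one]
    change ∑ r, L r * V⁻¹ * (V * single s t 1 * Vᴴ) * (L r * V⁻¹)ᴴ = _
    simp_rw [h]
    ext p q
    rw [Matrix.sum_apply, Matrix.mul_apply]
    refine Finset.sum_congr rfl fun r _ => ?_
    simp [Matrix.mul_apply, single_apply, hL, ite_and]

/-- The fidelity does not decrease under quantum channels: a channel maps an optimal block matrix for
`A`, `B` to an admissible one for the images and keeps the trace of the off-diagonal block. -/
theorem fidelity_le_fidelity_map {d d' : ℕ} (T : QuantumChannel d d')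
    {A B : Matrix (Fin d) (Fin d) ℂ} (hA : A.PosSemidef) (hB : B.PosSemidef) :
    fidelity A B ≤ fidelity (T.toLinearMap A) (T.toLinearMap B) := by
  have hF : 0 ≤ fidelity A B :=
    (Complex.le_def.1 (posSemidef_sqrt (CFC.sqrt A * B * CFC.sqrt A)).trace_nonneg).1
  obtain ⟨G, H, rfl, rfl, h⟩ := exists_gram_of_norm_le_fidelity hA hB (c := fidelity A B)
    (by rw [Complex.norm_real, Real.norm_of_nonneg hF])
  obtain ⟨K, hK⟩ := T.exists_gram ![G, H]
  have h00 := hK 0 0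
  have h01 := hK 0 1
  have h11 := hK 1 1
  simp only [cons_val_zero, cons_val_one] at h00 h01 h11
  have := norm_trace_mul_conjTranspose_le_fidelity (K 0) (K 1)
  rw [← h00, ← h01, ← h11, T.trace_preserving, h, Complex.norm_real, Real.norm_of_nonneg hF] at this
  exact this

theorem QuantumChannel.map_posSemidef {d d' : ℕ} (T : QuantumChannel d d')
    {A : Matrix (Fin d) (Fin d) ℂ} (hA : A.PosSemidef) : (T.toLinearMap A).PosSemidef := by
  obtain ⟨K, hK⟩ := T.exists_gram fun _ : Fin 1 => CFC.sqrt A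
  have h := hK 0 0
  rw [(posSemidef_sqrt A).isHermitian.eq, sqrt_mul_sqrt_of_posSemidef hA] at h
  rw [h]
  exact posSemidef_self_mul_conjTranspose _

/-! ### The extremal combinations of two density matrices -/

theorem IsDensityMatrix.le_one_of_sub_smul_posSemidef {d : ℕ} {ρ σ : Matrix (Fin d) (Fin d) ℂ}
    (hρ : IsDensityMatrix ρ) (hσ : IsDensityMatrix σ) {t : ℝ} (ht : (ρ - t • σ).PosSemidef) :
    t ≤ 1 := by
  have := (Complex.le_def.1 ht.trace_nonneg).1
  rw [trace_sub, trace_smul, hρ.trace_eq_one, hσ.trace_eq_one] at this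
  simpa using this

theorem IsDensityMatrix.isGreatest_infRatio {d : ℕ} {ρ σ : Matrix (Fin d) (Fin d) ℂ}
    (hρ : IsDensityMatrix ρ) (hσ : IsDensityMatrix σ) :
    IsGreatest {t : ℝ | (ρ - t • σ).PosSemidef} (infRatio ρ σ) := by
  set S := {t : ℝ | (ρ - t • σ).PosSemidef} with hS
  have h0 : (0 : ℝ) ∈ S := by simpa [hS] using hρ.posSemidef
  have hb : BddAbove S := ⟨1, fun t ht => hρ.le_one_of_sub_smul_posSemidef hσ ht⟩
  have hcl : IsClosed S := by
    have : S = (fun t : ℝ => ρ - t • σ) ⁻¹' {X | 0 ≤ X} := by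
      ext t; simp [hS, nonneg_iff_posSemidef]
    rw [this]
    exact CStarAlgebra.isClosed_nonneg.preimage (by fun_prop)
  exact ⟨hcl.csSup_mem ⟨0, h0⟩ hb, fun t ht => le_csSup hb ht⟩

theorem IsDensityMatrix.sub_infRatio_smul_posSemidef {d : ℕ} {ρ σ : Matrix (Fin d) (Fin d) ℂ}
    (hρ : IsDensityMatrix ρ) (hσ : IsDensityMatrix σ) : (ρ - infRatio ρ σ • σ).PosSemidef :=
  (hρ.isGreatest_infRatio hσ).1

theorem IsDensityMatrix.infRatio_nonneg {d : ℕ} {ρ σ : Matrix (Fin d) (Fin d) ℂ}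
    (hρ : IsDensityMatrix ρ) (hσ : IsDensityMatrix σ) : 0 ≤ infRatio ρ σ :=
  (hρ.isGreatest_infRatio hσ).2 (by simpa using hρ.posSemidef)

/-- By maximality of `inf(ρ/σ)`, the difference `ρ - inf(ρ/σ) σ` lies on the boundary of the
positive semidefinite cone. -/
theorem IsDensityMatrix.det_sub_infRatio_smul {d : ℕ} {ρ σ : Matrix (Fin d) (Fin d) ℂ}
    (hρ : IsDensityMatrix ρ) (hσ : IsDensityMatrix σ) : (ρ - infRatio ρ σ • σ).det = 0 := by
  obtain ⟨hpsd, hmax⟩ := hρ.isGreatest_infRatio hσ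
  rw [Set.mem_ofPred_eq] at hpsd
  set A := ρ - infRatio ρ σ • σ with hA
  by_contra hdet
  have : Nontrivial (Matrix (Fin d) (Fin d) ℂ) := by
    refine ⟨σ, 0, fun h => ?_⟩
    have := hσ.trace_eq_one
    simp [h] at this
  have hpos : IsStrictlyPositive A :=
    (hpsd.posDef_iff_det_ne_zero.2 hdet).isStrictlyPositive
  obtain ⟨r, hr, hrA⟩ := (CFC.exists_pos_algebraMap_le_iff hpos.isSelfAdjoint).2
    fun x hx => hpos.spectrum_pos hx
  have hσ' : σ ≤ algebraMap ℝ _ ‖σ‖ :=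
    IsSelfAdjoint.le_algebraMap_norm_self hσ.posSemidef.isHermitian
  have hσ0 := norm_nonneg σ
  -- `ε` is small enough for `ε σ ≤ r ≤ A`, so that `inf(ρ/σ) + ε` would still be admissible
  set ε := r / (‖σ‖ + 1) with hε
  have hε0 : 0 < ε := by positivity
  have hle : ε • σ ≤ A := by
    refine le_trans ?_ hrA
    calc ε • σ ≤ ε • algebraMap ℝ _ ‖σ‖ := smul_le_smul_of_nonneg_left hσ' hε0.le
      _ = algebraMap ℝ _ (ε * ‖σ‖) := by rw [map_mul, Algebra.smul_def]
      _ ≤ algebraMap ℝ _ r := by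
        refine algebraMap_mono _ ?_
        rw [hε, div_mul_eq_mul_div, div_le_iff₀ (by positivity)]
        nlinarith
  have h : (ρ - (infRatio ρ σ + ε) • σ).PosSemidef := by
    have := le_iff.1 hle
    rwa [hA, sub_sub, ← add_smul] at this
  linarith [hmax h]

theorem IsDensityMatrix.infRatio_self {d : ℕ} {ρ : Matrix (Fin d) (Fin d) ℂ}
    (hρ : IsDensityMatrix ρ) : infRatio ρ ρ = 1 := by
  obtain ⟨h1, hmax⟩ := hρ.isGreatest_infRatio hρ
  exact le_antisymm (hρ.le_one_of_sub_smul_posSemidef hρ h1)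
    (hmax (by simpa using Matrix.PosSemidef.zero))

theorem IsDensityMatrix.eq_of_sub_posSemidef {d : ℕ} {ρ σ : Matrix (Fin d) (Fin d) ℂ}
    (hρ : IsDensityMatrix ρ) (hσ : IsDensityMatrix σ) (h : (ρ - σ).PosSemidef) : ρ = σ :=
  sub_eq_zero.1 <| h.trace_eq_zero_iff.1 <| by
    rw [Matrix.trace_sub, hρ.trace_eq_one, hσ.trace_eq_one, sub_self]

theorem IsDensityMatrix.infRatio_lt_one {d : ℕ} {ρ σ : Matrix (Fin d) (Fin d) ℂ}
    (hρ : IsDensityMatrix ρ) (hσ : IsDensityMatrix σ) (hne : ρ ≠ σ) : infRatio ρ σ < 1 := by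
  have hpsd := hρ.sub_infRatio_smul_posSemidef hσ
  refine lt_of_le_of_ne (hρ.le_one_of_sub_smul_posSemidef hσ hpsd) fun h => hne (hρ.eq_of_sub_posSemidef hσ ?_)
  rwa [h, one_smul] at hpsd

theorem Matrix.PosSemidef.exists_vecMulVec_of_det_eq_zero {A : Matrix (Fin 2) (Fin 2) ℂ}
    (hA : A.PosSemidef) (hdet : A.det = 0) : ∃ x : Fin 2 → ℂ, vecMulVec x (star x) = A := by
  obtain ⟨p, hp, hp'⟩ : ∃ p : ℝ, 0 ≤ p ∧ A 0 0 = p := by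
    have := Complex.nonneg_iff.1 (hA.diag_nonneg (i := 0))
    exact ⟨_, this.1, Complex.ext rfl this.2.symm⟩
  obtain ⟨r, hr, hr'⟩ : ∃ r : ℝ, 0 ≤ r ∧ A 1 1 = r := by
    have := Complex.nonneg_iff.1 (hA.diag_nonneg (i := 1))
    exact ⟨_, this.1, Complex.ext rfl this.2.symm⟩
  have hq : A 1 0 = star (A 0 1) := (hA.isHermitian.apply 1 0).symm
  rw [det_fin_two, hp', hr', hq, sub_eq_zero] at hdet
  have hsq : ∀ t : ℝ, 0 ≤ t → ((√t : ℝ) : ℂ) * (√t : ℝ) = t := fun t ht => by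
    rw [← Complex.ofReal_mul, Real.mul_self_sqrt ht]
  obtain rfl | hp0 := hp.eq_or_lt
  · have hq0 : A 0 1 = 0 := by
      simpa using hdet.symm
    refine ⟨![0, (√r : ℝ)], ?_⟩
    ext i j
    fin_cases i <;> fin_cases j <;> simp [vecMulVec_apply, hp', hr', hq, hq0, hsq r hr]
  · have hs : ((√p : ℝ) : ℂ) ≠ 0 := by
      simpa using (Real.sqrt_pos.2 hp0).ne'
    have hpc : (p : ℂ) ≠ 0 := by simpa using hp0.ne'
    refine ⟨![(√p : ℝ), star (A 0 1) / (√p : ℝ)], ?_⟩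
    ext i j
    fin_cases i <;> fin_cases j
    · simp [vecMulVec_apply, hp', hsq p hp]
    · simp [vecMulVec_apply]; field_simp
    · simp [vecMulVec_apply, hq]; field_simp
    · simp [vecMulVec_apply, hr']
      rw [div_mul_div_comm, hsq p hp, div_eq_iff hpc, mul_comm, ← Complex.star_def, ← hdet,
        mul_comm]

theorem Matrix.IsHermitian.eq_zero_of_trace_eq_zero_of_det_eq_zero {D : Matrix (Fin 2) (Fin 2) ℂ}
    (hD : D.IsHermitian) (htr : D.trace = 0) (hdet : D.det = 0) : D = 0 := by
  have h : D * Dᴴ = 0 := by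
    rw [hD.eq]
    rw [trace_fin_two] at htr
    rw [det_fin_two] at hdet
    have h11 : D 1 1 = -D 0 0 := by linear_combination htr
    rw [h11] at hdet
    ext i j
    fin_cases i <;> fin_cases j <;> simp [Matrix.mul_apply, Fin.sum_univ_two, h11] <;>
      first | linear_combination -hdet | ring
  exact self_mul_conjTranspose_eq_zero.1 h

/-! ### Existence of the channel -/

theorem exists_channel_map_eq_trace_smul (d : ℕ) {d' : ℕ} {σ : Matrix (Fin d') (Fin d') ℂ}
    (hσ : IsDensityMatrix σ) :
    ∃ T : QuantumChannel d d', ∀ X, T.toLinearMap X = X.trace • σ := by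
  set S := CFC.sqrt σ with hS
  have hS' : S.IsHermitian := (posSemidef_sqrt σ).isHermitian
  have hSS : S * S = σ := sqrt_mul_sqrt_of_posSemidef hσ.posSemidef
  set G : Fin d → Matrix (Fin d') (Fin d × Fin d') ℂ :=
    fun s => of fun p uq => if s = uq.1 then S p uq.2 else 0 with hG
  have hGG : ∀ s t, G s * (G t)ᴴ = if s = t then σ else 0 := fun s t => by
    ext p q
    rw [Matrix.mul_apply, Fintype.sum_prod_type]
    simp only [hG, of_apply, conjTranspose_apply, apply_ite star, star_zero, hS'.apply]
    split_ifs with h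
    · subst h
      simp [← hSS, Matrix.mul_apply]
    · refine Finset.sum_eq_zero fun u _ => Finset.sum_eq_zero fun x _ => ?_
      split_ifs with h1 h2 <;> simp_all
  obtain ⟨T, hT⟩ := QuantumChannel.exists_of_gram (1 : Matrix (Fin d) (Fin d) ℂ) (by simp) G
    fun s t => by
      rw [hGG, conjTranspose_one, Matrix.one_mul, one_apply]
      split_ifs with h1 h2 h2 <;> simp_all [hσ.trace_eq_one]
  refine ⟨T, fun X => ?_⟩
  have hT' : ∀ s t c, T.toLinearMap (single s t c) = c • if s = t then σ else 0 := fun s t c => by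
    rw [← hGG, ← hT, ← map_smul]; simp
  conv_lhs => rw [matrix_eq_sum_single X]
  simp [map_sum, hT', trace, Finset.sum_smul]

/-- Sufficiency for two distinct qubit states, by `QuantumChannel.exists_of_gram`: the extremal
combinations of the states are `x xᴴ` and `y yᴴ` with `x`, `y` linearly independent, and the
fidelity condition provides an off-diagonal block with the trace of `x yᴴ`. -/
theorem exists_channel_of_fidelity_le {d' : ℕ} {ρ₁ ρ₂ : Matrix (Fin 2) (Fin 2) ℂ}
    {σ₁ σ₂ : Matrix (Fin d') (Fin d') ℂ}
    (hρ₁ : IsDensityMatrix ρ₁) (hρ₂ : IsDensityMatrix ρ₂) (hne : ρ₁ ≠ ρ₂)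
    (hσ₁ : IsDensityMatrix σ₁) (hσ₂ : IsDensityMatrix σ₂)
    {a b : ℝ} (ha : a = infRatio ρ₁ ρ₂) (hb : b = infRatio ρ₂ ρ₁)
    (hA' : (σ₁ - a • σ₂).PosSemidef) (hB' : (σ₂ - b • σ₁).PosSemidef)
    (hF : fidelity (ρ₁ - a • ρ₂) (ρ₂ - b • ρ₁) ≤ fidelity (σ₁ - a • σ₂) (σ₂ - b • σ₁)) :
    ∃ T : QuantumChannel 2 d', T.toLinearMap ρ₁ = σ₁ ∧ T.toLinearMap ρ₂ = σ₂ := by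
  have ha0 : 0 ≤ a := ha ▸ hρ₁.infRatio_nonneg hρ₂
  have hb0 : 0 ≤ b := hb ▸ hρ₂.infRatio_nonneg hρ₁
  have hA := ha ▸ hρ₁.sub_infRatio_smul_posSemidef hρ₂
  have hB := hb ▸ hρ₂.sub_infRatio_smul_posSemidef hρ₁
  have ha1 : a < 1 := ha ▸ hρ₁.infRatio_lt_one hρ₂ hne
  have hb1 : b < 1 := hb ▸ hρ₂.infRatio_lt_one hρ₁ hne.symm
  have hab : (1 - a * b) ≠ 0 := by nlinarith
  obtain ⟨x, hx⟩ := hA.exists_vecMulVec_of_det_eq_zero (ha ▸ hρ₁.det_sub_infRatio_smul hρ₂)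
  obtain ⟨y, hy⟩ := hB.exists_vecMulVec_of_det_eq_zero (hb ▸ hρ₂.det_sub_infRatio_smul hρ₁)
  set V : Matrix (Fin 2) (Fin 2) ℂ := of fun i s => ![x, y] s i with hV
  have hV00 : V * single 0 0 1 * Vᴴ = ρ₁ - a • ρ₂ := by
    rw [← hx]
    ext i j
    simp [hV, Matrix.mul_apply, vecMulVec_apply, Fin.sum_univ_two, single_apply]
  have hV11 : V * single 1 1 1 * Vᴴ = ρ₂ - b • ρ₁ := by
    rw [← hy]
    ext i j
    simp [hV, Matrix.mul_apply, vecMulVec_apply, Fin.sum_univ_two, single_apply]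
  -- If `x`, `y` were dependent, `ρ₁ - ρ₂`, a combination of `x xᴴ` and `y yᴴ`, would be a singular
  -- traceless Hermitian matrix and hence zero.
  have hVdet : V.det ≠ 0 := by
    intro h0
    have key : (1 - a * b) • (ρ₁ - ρ₂)
        = V * diagonal ![((1 - b : ℝ) : ℂ), ((a - 1 : ℝ) : ℂ)] * Vᴴ := by
      have hdiag : diagonal ![((1 - b : ℝ) : ℂ), ((a - 1 : ℝ) : ℂ)]
          = (1 - b) • single (0 : Fin 2) (0 : Fin 2) (1 : ℂ) - (1 - a) • single 1 1 1 := by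
        ext i j
        fin_cases i <;> fin_cases j <;> simp
      rw [hdiag, Matrix.mul_sub, Matrix.sub_mul, Matrix.mul_smul, Matrix.mul_smul, Matrix.smul_mul,
        Matrix.smul_mul, hV00, hV11]
      module
    have hz := Matrix.IsHermitian.eq_zero_of_trace_eq_zero_of_det_eq_zero
      (D := (1 - a * b) • (ρ₁ - ρ₂)) ((hρ₁.posSemidef.isHermitian.sub hρ₂.posSemidef.isHermitian).smul
        (IsSelfAdjoint.all _))
      (by simp [hρ₁.trace_eq_one, hρ₂.trace_eq_one]) (by rw [key, det_mul, det_mul, h0]; simp)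
    exact hne (sub_eq_zero.1 ((smul_eq_zero.1 hz).resolve_left hab))
  have hc : ‖(Vᴴ * V) 1 0‖ ≤ fidelity (σ₁ - a • σ₂) (σ₂ - b • σ₁) := by
    refine le_trans ?_ hF
    have h := norm_trace_mul_conjTranspose_le_fidelity
      (of fun i (_ : Fin 1) => x i) (of fun i (_ : Fin 1) => y i)
    have h1 : ∀ z w : Fin 2 → ℂ, (of fun i (_ : Fin 1) => z i) * (of fun i (_ : Fin 1) => w i)ᴴ
        = vecMulVec z (star w) := fun z w => by
      ext i j; simp [Matrix.mul_apply, vecMulVec_apply]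
    rw [h1, h1, h1, hx, hy] at h
    have h2 : (Vᴴ * V) 1 0 = (vecMulVec x (star y)).trace := by
      simp [hV, Matrix.mul_apply, Fin.sum_univ_two, mul_comm]
    rwa [h2]
  obtain ⟨G, H, hG, hH, hGH⟩ := exists_gram_of_norm_le_fidelity hA' hB' hc
  have htr : ∀ s, (V * single s s 1 * Vᴴ).trace = (Vᴴ * V) s s := fun s => by
    rw [trace_mul_comm, ← Matrix.mul_assoc, trace_mul_single]; simp
  obtain ⟨T, hT⟩ := QuantumChannel.exists_of_gram V hVdet.isUnit ![G, H] (by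
    intro s t
    fin_cases s <;> fin_cases t
    · change (G * Gᴴ).trace = (Vᴴ * V) 0 0
      rw [hG, ← htr, hV00]
      simp [hρ₁.trace_eq_one, hρ₂.trace_eq_one, hσ₁.trace_eq_one, hσ₂.trace_eq_one]
    · exact hGH
    · change (H * Gᴴ).trace = (Vᴴ * V) 0 1
      have h := congrArg star hGH
      rwa [← trace_conjTranspose, conjTranspose_mul, conjTranspose_conjTranspose,
        (isHermitian_conjTranspose_mul_self V).apply] at h
    · change (H * Hᴴ).trace = (Vᴴ * V) 1 1
      rw [hH, ← htr, hV11]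
      simp [hρ₁.trace_eq_one, hρ₂.trace_eq_one, hσ₁.trace_eq_one, hσ₂.trace_eq_one])
  have hTA : T.toLinearMap (ρ₁ - a • ρ₂) = σ₁ - a • σ₂ := by
    rw [← hV00, hT]; exact hG
  have hTB : T.toLinearMap (ρ₂ - b • ρ₁) = σ₂ - b • σ₁ := by
    rw [← hV11, hT]; exact hH
  rw [map_sub, LinearMap.map_smul_of_tower] at hTA hTB
  rw [sub_eq_iff_eq_add] at hTA hTB
  refine ⟨T, smul_right_injective _ hab ?_, smul_right_injective _ hab ?_⟩
  · change (1 - a * b) • T.toLinearMap ρ₁ = (1 - a * b) • σ₁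
    rw [hTB] at hTA
    have h : T.toLinearMap ρ₁ - (a * b) • T.toLinearMap ρ₁ = σ₁ - (a * b) • σ₁ := by
      nth_rewrite 1 [hTA]
      module
    simpa only [sub_smul, one_smul] using h
  · change (1 - a * b) • T.toLinearMap ρ₂ = (1 - a * b) • σ₂
    rw [hTA] at hTB
    have h : T.toLinearMap ρ₂ - (a * b) • T.toLinearMap ρ₂ = σ₂ - (a * b) • σ₂ := by
      nth_rewrite 1 [hTB]
      module
    simpa only [sub_smul, one_smul] using h

end

theorem mainTheorem5 (d d' : ℕ) (hd : d ≤ 2)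
    (ρ₁ ρ₂ : Matrix (Fin d) (Fin d) ℂ) (hρ₁ : IsDensityMatrix ρ₁) (hρ₂ : IsDensityMatrix ρ₂)
    (σ₁ σ₂ : Matrix (Fin d') (Fin d') ℂ) (hσ₁ : IsDensityMatrix σ₁) (hσ₂ : IsDensityMatrix σ₂)
    (a b : ℝ) (ha : a = infRatio ρ₁ ρ₂) (hb : b = infRatio ρ₂ ρ₁) :
    (∃ T : QuantumChannel d d', T.toLinearMap ρ₁ = σ₁ ∧ T.toLinearMap ρ₂ = σ₂) ↔
      ((σ₁ - a • σ₂).PosSemidef ∧ (σ₂ - b • σ₁).PosSemidef ∧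
        fidelity (ρ₁ - a • ρ₂) (ρ₂ - b • ρ₁) ≤ fidelity (σ₁ - a • σ₂) (σ₂ - b • σ₁)) := by
  constructor
  · rintro ⟨T, rfl, rfl⟩
    have hA := ha ▸ hρ₁.sub_infRatio_smul_posSemidef hρ₂
    have hB := hb ▸ hρ₂.sub_infRatio_smul_posSemidef hρ₁
    simp only [← LinearMap.map_smul_of_tower, ← map_sub]
    exact ⟨T.map_posSemidef hA, T.map_posSemidef hB, fidelity_le_fidelity_map T hA hB⟩
  · rintro ⟨hA', hB', hF⟩
    obtain rfl | hne := eq_or_ne ρ₁ ρ₂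
    · obtain rfl : a = 1 := ha.trans hρ₁.infRatio_self
      rw [one_smul] at hA'
      obtain rfl := hσ₁.eq_of_sub_posSemidef hσ₂ hA'
      obtain ⟨T, hT⟩ := exists_channel_map_eq_trace_smul d hσ₁
      have h : T.toLinearMap ρ₁ = σ₁ := by rw [hT, hρ₁.trace_eq_one, one_smul]
      exact ⟨T, h, h⟩
    · have hd2 : d = 2 := by
        interval_cases d
        · exact absurd (Subsingleton.elim _ _) hne
        · refine absurd ?_ hne
          ext i j
          have h := hρ₁.trace_eq_one.trans hρ₂.trace_eq_one.symm
          simp only [Matrix.trace_fin_one] at h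
          rwa [Subsingleton.elim i 0, Subsingleton.elim j 0]
        · rfl
      subst hd2
      exact exists_channel_of_fidelity_le hρ₁ hρ₂ hne hσ₁ hσ₂ ha hb hA' hB' hF
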